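/- For a positive integer $n$, the $n$-adic intervals are the intervals $\left[\frac{k-1}{n^m},\frac{k}{n^m}\right)$ with $m,k\in\mathbb Z$. The $n$-adic children of such an interval are the $n$ intervals $\left[\frac{k-1}{n^m}+\frac{j-1}{n^{m+1}},\frac{k-1}{n^m}+\frac{j}{n^{m+1}}\right)$, $1\le j\le n$, and two children of the same $n$-adic interval are called siblings. A Borel measure $\mu$ on $\mathbb R$ is $n$-adic doubling if there is a constant $C>0$ such that $\frac1C\le\frac{\mu(J_1)}{\mu(J_2)}\le C$ for all siblings $J_1,J_2$ (in particular $0<\mu(J)<\infty$ for every $n$-adic interval $J$). It is doubling if there is a constant $C>0$ such that $\mu(2I)\le C\mu(I)$ for every bounded interval $I\subset\mathbb R$ of positive length, where $2I$ is the interval with the same midpoint as $I$ and twice its length. Theorem. For any positive integers $u$ and $v$ there is an infinite family of Borel measures on $\mathbb R$, no two of which are constant multiples of each other, such that every member of the family is both $u$-adic doubling and $v$-adic doubling, but is not doubling. Moreover, for every member $\mu$ the failure of doubling already occurs inside the unit interval: there is no constant $C>0$ such that $\mu(2I)\le C\mu(I)$ for all intervals $I$ with $2I\subset(0,1)$. 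-/

import Mathlib

open MeasureTheory
open scoped NNReal ENNReal

/-- The `j`-th `n`-adic child (`1 ≤ j ≤ n`) of the `n`-adic interval `[(k-1)/n^m, k/n^m)`,
where `m` and `k` are arbitrary integers. -/
def adicChild (n : ℕ) (m k : ℤ) (j : ℕ) : Set ℝ :=
  Set.Ico (((k : ℝ) - 1) / (n : ℝ) ^ m + ((j : ℝ) - 1) / (n : ℝ) ^ (m + 1))
    (((k : ℝ) - 1) / (n : ℝ) ^ m + (j : ℝ) / (n : ℝ) ^ (m + 1))

/-- `J₁` and `J₂` are `n`-adic siblings: both are children of one `n`-adic interval. -/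
def IsAdicSibling (n : ℕ) (J₁ J₂ : Set ℝ) : Prop :=
  ∃ m k : ℤ, ∃ i ∈ Finset.Icc 1 n, ∃ j ∈ Finset.Icc 1 n,
    J₁ = adicChild n m k i ∧ J₂ = adicChild n m k j

/-- `μ` is an `n`-adic doubling measure. The quotient is taken in `[0, ∞]`, where
`0 / 0 = ∞ / ∞ = 0`, so that (taking `J₁ = J₂`) the lower bound makes `μ` positive and finite
on every child of an `n`-adic interval, hence on every `n`-adic interval. -/
def IsAdicDoubling (n : ℕ) (μ : Measure ℝ) : Prop :=
  ∃ C : ℝ≥0, 0 < C ∧ ∀ J₁ J₂ : Set ℝ, IsAdicSibling n J₁ J₂ →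
    (C : ℝ≥0∞)⁻¹ ≤ μ J₁ / μ J₂ ∧ μ J₁ / μ J₂ ≤ (C : ℝ≥0∞)

/-- The doubling inequality `μ (2I) ≤ C * μ I`, with one constant `C`, for all the intervals
`I = [c - r, c + r)` whose double `2I = [c - 2r, c + 2r)` lies in `S`. -/
def IsDoublingOn (S : Set ℝ) (μ : Measure ℝ) : Prop :=
  ∃ C : ℝ≥0, 0 < C ∧ ∀ c r : ℝ, 0 < r → Set.Ico (c - 2 * r) (c + 2 * r) ⊆ S →
    μ (Set.Ico (c - 2 * r) (c + 2 * r)) ≤ (C : ℝ≥0∞) * μ (Set.Ico (c - r) (c + r))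

/-- `μ` is a doubling measure on the real line. -/
def IsDoubling (μ : Measure ℝ) : Prop :=
  IsDoublingOn Set.univ μ

/-! Take Lebesgue measure plus a density supported just left of a point `x`, shaped as a tent in
`log (x - y)` between the scales `δ` and `Δ = q² δ`. Its peak, of height `log q`, is at distance `ρ
= Δ / q`, and it vanishes right of `x`. Hence `[x, x + 2ρ)` has only Lebesgue mass, while its double
has bump mass at least of order `ρ log q`, so the doubling constant is unbounded in `q`.

Adic intervals do not detect this if `x` lies within `δ` to the right of a point `a` interior to no
adic interval shorter than `Δ`. A shorter interval then lies left of `x`, where the density is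
1-Lipschitz in the logarithm, or right of `x - δ`, where it is zero; on longer ones the total bump
mass, at most `Δ`, is harmless. All constants depend on `n` alone. Dirichlet approximation supplies
such points for `u` and `v` within `δ` of each other (`exists_isAdicSeparator_near`).

Bumps with growing `q` are summed with weights `2⁻ⁱ`. One bump could fill the gap of another, so
Baire category selects a subfamily whose sum is not doubling (`exists_selectedSum_not_doubling`).
Varying the multiple of Lebesgue measure gives infinitely many examples. -/

/-! ### The logarithmic tent and its averages -/

/-- A tent in the logarithmic scale: it vanishes outside `[δ, Δ]` and has slopes `±1` with respect
to `log s`. -/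
noncomputable def logTent (δ Δ s : ℝ) : ℝ :=
  max 0 (min (Real.log (max s δ) - Real.log δ) (Real.log Δ - Real.log (max s δ)))

theorem logTent_nonneg (δ Δ s : ℝ) : 0 ≤ logTent δ Δ s := le_max_left _ _

theorem continuous_logTent {δ : ℝ} (hδ : 0 < δ) (Δ : ℝ) : Continuous (logTent δ Δ) := by
  have h : Continuous fun s : ℝ => Real.log (max s δ) :=
    Continuous.log (by fun_prop) fun s => (lt_max_of_lt_right hδ).ne'
  unfold logTent
  fun_prop

theorem logTent_eq_zero_of_le {δ s : ℝ} (Δ : ℝ) (hs : s ≤ δ) : logTent δ Δ s = 0 := by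
  simp [logTent, max_eq_right hs]

theorem logTent_eq_zero_of_ge {δ Δ s : ℝ} (hΔ : 0 < Δ) (hs : Δ ≤ s) : logTent δ Δ s = 0 := by
  have := Real.log_le_log hΔ (hs.trans (le_max_left s δ))
  exact max_eq_left ((min_le_right _ _).trans (by linarith))

theorem logTent_le_log_sub_log {Δ s : ℝ} (δ : ℝ) (hs : 0 < s) (hsΔ : s ≤ Δ) :
    logTent δ Δ s ≤ Real.log Δ - Real.log s := by
  have h1 := Real.log_le_log hs hsΔ
  have h2 := Real.log_le_log hs (le_max_left s δ)
  exact max_le (by linarith) ((min_le_right _ _).trans (by linarith))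

theorem logTent_le {δ Δ : ℝ} (hδ : 0 < δ) (hδΔ : δ ≤ Δ) (s : ℝ) :
    logTent δ Δ s ≤ Real.log Δ - Real.log δ := by
  have h1 := Real.log_le_log hδ hδΔ
  have h2 := Real.log_le_log hδ (le_max_right s δ)
  exact max_le (by linarith) ((min_le_right _ _).trans (by linarith))

theorem abs_log_max_sub_log_max_le {δ s t : ℝ} (hδ : 0 < δ) (hs : 0 < s) (ht : 0 < t) :
    |Real.log (max t δ) - Real.log (max s δ)| ≤ |Real.log t - Real.log s| := by
  have key : ∀ z, 0 < z → Real.log (max z δ) = max (Real.log z) (Real.log δ) := fun z hz => by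
    rcases le_total z δ with h | h
    · rw [max_eq_right h, max_eq_right (Real.log_le_log hz h)]
    · rw [max_eq_left h, max_eq_left (Real.log_le_log hδ h)]
  rw [key t ht, key s hs]
  exact (abs_max_sub_max_le_abs _ _ _)

theorem logTent_le_add {δ s t : ℝ} (Δ : ℝ) (hδ : 0 < δ) (hs : 0 < s) (ht : 0 < t) :
    logTent δ Δ t ≤ logTent δ Δ s + |Real.log t - Real.log s| := by
  have h := abs_le.1 (abs_log_max_sub_log_max_le hδ hs ht)
  unfold logTent
  grind

theorem integral_log_sub_log_le {σ τ : ℝ} (hσ : 0 ≤ σ) (hστ : σ ≤ τ) :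
    ∫ t in σ..τ, (Real.log τ - Real.log t) ≤ τ - σ := by
  rw [intervalIntegral.integral_sub (by simp) (by simp), integral_log]
  simp only [intervalIntegral.integral_const, smul_eq_mul]
  rcases hσ.eq_or_lt with rfl | h
  · simp
  · have := mul_le_mul_of_nonneg_left (Real.log_le_log h hστ) hσ
    linarith

/-- The tent is 1-Lipschitz in `log s` and the logarithm has bounded mean oscillation. The large
integral is compared with the value at each `s` in the right half of the subinterval, where `s` is
not small relative to `τ`, then averaged over `s`. -/
theorem integral_logTent_le_of_subinterval {δ σ τ σ' τ' : ℝ} (Δ : ℝ) {n : ℕ} (hδ : 0 < δ)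
    (h0 : 0 ≤ σ) (h1 : σ ≤ σ') (h2 : σ' < τ') (h3 : τ' ≤ τ)
    (hn : τ - σ ≤ n * (τ' - σ')) :
    ∫ t in σ..τ, logTent δ Δ t ≤
      2 * n * (∫ t in σ'..τ', logTent δ Δ t) + (2 * n + 1) * n * (τ' - σ') := by
  have hc := continuous_logTent hδ Δ
  have hi : ∀ a b, IntervalIntegrable (logTent δ Δ) volume a b :=
    fun a b => hc.intervalIntegrable a b
  have hστ : σ ≤ τ := by linarith
  set A := ∫ t in σ..τ, logTent δ Δ t with hA
  have step : ∀ s ∈ Set.Icc ((σ' + τ') / 2) τ',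
      A ≤ (τ - σ) * logTent δ Δ s + (2 * n + 1) * (τ - σ) := by
    rintro s ⟨hs1, hs2⟩
    have hs : 0 < s := by linarith
    have hls : Real.log τ - Real.log s ≤ 2 * n := by
      rw [← Real.log_div (by linarith) hs.ne']
      -- Since `s ≥ σ + (τ' - σ') / 2`, `τ - s ≤ n (τ' - σ') ≤ 2 n s`.
      refine (Real.log_le_sub_one_of_pos (by apply div_pos <;> linarith)).trans ?_
      rw [sub_le_iff_le_add, div_le_iff₀ hs]
      nlinarith [mul_le_mul_of_nonneg_left (show (τ' - σ') / 2 ≤ s by linarith)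
        (Nat.cast_nonneg (α := ℝ) n)]
    have : A ≤ ∫ t in σ..τ, ((logTent δ Δ s + 2 * n) + (Real.log τ - Real.log t)) := by
      refine intervalIntegral.integral_mono_on_of_le_Ioo hστ (hi _ _) (by simp) fun t ht => ?_
      have ht0 : 0 < t := by linarith [ht.1]
      have h4 := Real.log_le_log ht0 ht.2.le
      have h5 := Real.log_le_log hs (hs2.trans h3)
      have h6 : |Real.log t - Real.log s| ≤
          (Real.log τ - Real.log t) + (Real.log τ - Real.log s) :=
        abs_le.2 ⟨by linarith, by linarith⟩
      linarith [logTent_le_add Δ hδ hs ht0]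
    rw [intervalIntegral.integral_add (by simp) (by simp)] at this
    have h7 := integral_log_sub_log_le h0 hστ
    simp only [intervalIntegral.integral_const, smul_eq_mul] at this
    linarith
  have hint : (τ' - σ') / 2 * A ≤
      (τ - σ) * (∫ t in σ'..τ', logTent δ Δ t) + (2 * n + 1) * (τ - σ) * ((τ' - σ') / 2) := by
    have h8 : ∫ s in ((σ' + τ') / 2)..τ', A ≤ ∫ s in ((σ' + τ') / 2)..τ',
        ((τ - σ) * logTent δ Δ s + (2 * n + 1) * (τ - σ)) :=
      intervalIntegral.integral_mono_on (by linarith) (by simp)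
        (((hi _ _).const_mul _).add (by simp)) step
    rw [intervalIntegral.integral_add ((hi _ _).const_mul _) (by simp),
      intervalIntegral.integral_const_mul] at h8
    simp only [intervalIntegral.integral_const, smul_eq_mul] at h8
    have h9 := intervalIntegral.integral_add_adjacent_intervals (hi σ' ((σ' + τ') / 2))
      (hi ((σ' + τ') / 2) τ')
    have h10 : 0 ≤ ∫ t in σ'..((σ' + τ') / 2), logTent δ Δ t :=
      intervalIntegral.integral_nonneg (by linarith) fun t _ => logTent_nonneg _ _ _
    have h11 := mul_nonneg (sub_nonneg.2 hστ) h10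
    rw [← h9]
    linarith
  have hB : 0 ≤ ∫ t in σ'..τ', logTent δ Δ t :=
    intervalIntegral.integral_nonneg h2.le fun t _ => logTent_nonneg _ _ _
  set B := ∫ t in σ'..τ', logTent δ Δ t
  have hl : 0 < (τ' - σ') / 2 := by linarith
  refine le_of_mul_le_mul_left (hint.trans ?_) hl
  have e1 := mul_le_mul_of_nonneg_right hn hB
  have e2 := mul_le_mul_of_nonneg_right hn (show 0 ≤ (2 * n + 1 : ℝ) * ((τ' - σ') / 2) by positivity)
  linarith

theorem integral_logTent_le_width {δ Δ : ℝ} (hδ : 0 < δ) (hδΔ : δ ≤ Δ) :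
    Integrable (logTent δ Δ) ∧ ∫ s, logTent δ Δ s ≤ Δ := by
  have hΔ : 0 < Δ := hδ.trans_le hδΔ
  have h0 : ∀ s, s ∉ Set.Ioc 0 Δ → logTent δ Δ s = 0 := fun s hs => by
    by_cases h : 0 < s
    · exact logTent_eq_zero_of_ge hΔ (not_le.1 fun h' => hs ⟨h, h'⟩).le
    · exact logTent_eq_zero_of_le _ ((not_lt.1 h).trans hδ.le)
  have hc := continuous_logTent hδ Δ
  refine ⟨hc.integrable_of_hasCompactSupport (HasCompactSupport.intro isCompact_Icc
    fun s hs => h0 s fun h => hs (Set.Ioc_subset_Icc_self h)), ?_⟩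
  rw [← setIntegral_eq_integral_of_forall_compl_eq_zero h0,
    ← intervalIntegral.integral_of_le hΔ.le]
  refine (intervalIntegral.integral_mono_on_of_le_Ioo hΔ.le (hc.intervalIntegrable _ _)
    (by simp) fun t ht => logTent_le_log_sub_log δ ht.1 ht.2.le).trans
    ((integral_log_sub_log_le le_rfl hΔ.le).trans (by simp))

/-- The alternatives in `hP` are: a long interval, where the total mass `Δ` is absorbed by the
length; one left of the singularity, where the previous comparison applies; and one where the
density is zero. -/
theorem integral_logTent_sub_le_of_subinterval {δ Δ x α β α' β' : ℝ} {n : ℕ} (hδ : 0 < δ)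
    (hδΔ : δ ≤ Δ) (h1 : α ≤ α') (h2 : α' < β') (h3 : β' ≤ β) (hn : β - α ≤ n * (β' - α'))
    (hP : Δ ≤ β - α ∨ β ≤ x ∨ x - δ ≤ α) :
    ∫ y in α..β, logTent δ Δ (x - y) ≤
      2 * n * (∫ y in α'..β', logTent δ Δ (x - y)) + (2 * n + 1) * n * (β' - α') := by
  have hB : 0 ≤ ∫ y in α'..β', logTent δ Δ (x - y) :=
    intervalIntegral.integral_nonneg h2.le fun t _ => logTent_nonneg _ _ _
  have hn0 := Nat.cast_nonneg (α := ℝ) n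
  have hw : 0 ≤ (2 * n + 1 : ℝ) * n * (β' - α') := mul_nonneg (by positivity) (by linarith)
  rcases hP with h | h | h
  · have h4 : ∫ y in α..β, logTent δ Δ (x - y) ≤ Δ := by
      rw [intervalIntegral.integral_of_le (by linarith)]
      obtain ⟨hi, hle⟩ := integral_logTent_le_width hδ hδΔ
      refine (setIntegral_le_integral (hi.comp_sub_left x)
        (Filter.Eventually.of_forall fun y => logTent_nonneg _ _ _)).trans ?_
      rwa [integral_sub_left_eq_self]
    nlinarith [mul_nonneg hn0 hB, mul_nonneg hn0 (mul_nonneg hn0 (sub_nonneg.2 h2.le))]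
  · rw [intervalIntegral.integral_comp_sub_left (logTent δ Δ),
      intervalIntegral.integral_comp_sub_left (logTent δ Δ)]
    convert integral_logTent_le_of_subinterval (n := n) Δ hδ (sub_nonneg.2 h)
      (sub_le_sub_left h3 x) (sub_lt_sub_left h2 x) (sub_le_sub_left h1 x) (by linarith) using 2
    ring
  · have : ∫ y in α..β, logTent δ Δ (x - y) = 0 := by
      rw [intervalIntegral.integral_congr (g := fun _ => 0)]
      · simp
      · intro y hy
        rw [Set.uIcc_of_le (by linarith)] at hy
        exact logTent_eq_zero_of_le _ (by linarith [hy.1])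
    rw [this]
    positivity

/-! ### Nearby separators for two bases -/

/-- The point `a` is interior to no `n`-adic interval shorter than `Δ`. -/
def IsAdicSeparator (n : ℕ) (Δ a : ℝ) : Prop :=
  ∀ m k : ℤ, ((n : ℝ) ^ m)⁻¹ < Δ → a ≤ ((k : ℝ) - 1) / (n : ℝ) ^ m ∨ (k : ℝ) / (n : ℝ) ^ m ≤ a

theorem isAdicSeparator_div_pow {n : ℕ} {Δ : ℝ} (hn : 2 ≤ n) (M : ℕ) (j : ℤ)
    (hΔ : Δ ≤ ((n : ℝ) ^ M)⁻¹) : IsAdicSeparator n Δ ((j : ℝ) / (n : ℝ) ^ M) := by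
  intro m k hm
  have hn1 : (1 : ℝ) < n := by exact_mod_cast hn
  have hn0 : (0 : ℝ) < n := by linarith
  have h1 : (n : ℝ) ^ (M : ℤ) < (n : ℝ) ^ m := by
    have := hm.trans_le hΔ
    rw [zpow_natCast]
    exact (inv_lt_inv₀ (by positivity) (by positivity)).1 this
  have h2 : (M : ℤ) < m := (zpow_lt_zpow_iff_right₀ hn1).1 h1
  obtain ⟨d, rfl⟩ : ∃ d : ℕ, m = M + d := ⟨(m - M).toNat, by omega⟩
  have h3 : (j : ℝ) / (n : ℝ) ^ M = ((j * (n : ℤ) ^ d : ℤ) : ℝ) / (n : ℝ) ^ ((M : ℤ) + d) := by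
    rw [zpow_add₀ hn0.ne']
    push_cast
    rw [zpow_natCast, zpow_natCast]
    field_simp
  have hp : (0 : ℝ) < (n : ℝ) ^ ((M : ℤ) + d) := by positivity
  rw [h3, div_le_div_iff_of_pos_right hp, div_le_div_iff_of_pos_right hp]
  rcases le_or_gt (j * (n : ℤ) ^ d) (k - 1) with h | h
  · left; exact_mod_cast h
  · right; exact_mod_cast (show k ≤ j * (n : ℤ) ^ d by omega)

/-- Base 1 has only intervals of length 1, none shorter than `Δ ≤ 1`, so base 2 may replace it. -/
theorem IsAdicSeparator.of_max {n : ℕ} {Δ a : ℝ} (hn : 0 < n) (hΔ : Δ ≤ 1)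
    (h : IsAdicSeparator (max n 2) Δ a) : IsAdicSeparator n Δ a := by
  rcases (show n = 1 ∨ 2 ≤ n by omega) with rfl | h2
  · intro m k hm
    simp only [Nat.cast_one, one_zpow, inv_one] at hm
    linarith
  · rwa [max_eq_left h2] at h

theorem exists_isAdicSeparator_near {u v : ℕ} (hu : 0 < u) (hv : 0 < v) (T : ℝ) :
    ∃ q Δ a b : ℝ, T ≤ Real.log q ∧ 4 ≤ q ∧ 0 < Δ ∧ Δ ≤ 1 ∧ |a - b| ≤ Δ / q ^ 2 ∧
      IsAdicSeparator u Δ a ∧ IsAdicSeparator v Δ b ∧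
      0 < max a b - Δ / q ∧ max a b + 3 * (Δ / q) < 1 := by
  obtain ⟨U, hU⟩ : ∃ U, U = max u 2 := ⟨_, rfl⟩
  obtain ⟨V, hV⟩ : ∃ V, V = max v 2 := ⟨_, rfl⟩
  have hU2 : 2 ≤ U := hU ▸ le_max_right _ _
  have hV2 : 2 ≤ V := hV ▸ le_max_right _ _
  have hU1 : (1 : ℝ) < U := by exact_mod_cast hU2
  have hV1 : (1 : ℝ) < V := by exact_mod_cast hV2
  obtain ⟨m, hm⟩ := pow_unbounded_of_one_lt (max 4 (Real.exp T)) hU1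
  -- With `W = V ^ n > q²` and `Δ = W⁻¹`, both grids, of mesh `q⁻²` and `W⁻¹`, have mesh at least
  -- `Δ`.
  obtain ⟨n, hn⟩ := pow_unbounded_of_one_lt ((U : ℝ) ^ (2 * m)) hV1
  obtain ⟨q, hq⟩ : ∃ q : ℝ, q = (U : ℝ) ^ m := ⟨_, rfl⟩
  obtain ⟨W, hW⟩ : ∃ W : ℝ, W = (V : ℝ) ^ n := ⟨_, rfl⟩
  rw [← hq] at hm
  have hq4 : 4 < q := (le_max_left _ _).trans_lt hm
  have hqT : Real.exp T < q := (le_max_right _ _).trans_lt hm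
  have hN : (U : ℝ) ^ (2 * m) = q ^ 2 := by rw [hq, ← pow_mul, mul_comm]
  rw [hN, ← hW] at hn
  have hq2 : 16 < q ^ 2 := by nlinarith
  have hW0 : 0 < W := by linarith
  have hNnat : ((U ^ (2 * m) : ℕ) : ℝ) = q ^ 2 := by push_cast; exact hN
  have hNpos : 0 < U ^ (2 * m) - 1 := by
    have : 16 < U ^ (2 * m) := by
      have := hNnat ▸ hq2
      exact_mod_cast this
    omega
  -- Dirichlet with denominators up to `q² - 1` gives error `1 / q²` and keeps `k / q²` strictly
  -- inside `(0, 1)`. Exact coincidence of the grid points is allowed, so dependent bases need no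
  -- separate case.
  obtain ⟨j, k, hk0, hkN, hjk⟩ := Real.exists_int_int_abs_mul_sub_le (W / q ^ 2) hNpos
  have hN1 : ((U ^ (2 * m) - 1 : ℕ) : ℝ) = q ^ 2 - 1 := by
    rw [Nat.cast_sub (by omega), hNnat, Nat.cast_one]
  rw [hN1, sub_add_cancel] at hjk
  have hk1 : (1 : ℝ) ≤ k := by exact_mod_cast hk0
  have hk2 : (k : ℝ) ≤ q ^ 2 - 1 := by rw [← hN1]; exact_mod_cast hkN
  have hq0 : 0 < q := by linarith
  have hΔ1 : W⁻¹ ≤ (q ^ 2)⁻¹ := inv_anti₀ (by positivity) hn.le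
  have hWi : 0 < W⁻¹ := by positivity
  have hq2i : (q ^ 2)⁻¹ ≤ 1 := inv_le_one_of_one_le₀ (by linarith)
  have hab : |(k : ℝ) / q ^ 2 - j / W| ≤ W⁻¹ / q ^ 2 := by
    have e : (k : ℝ) / q ^ 2 - j / W = (k * (W / q ^ 2) - j) / W := by field_simp
    rw [e, abs_div, abs_of_pos hW0, div_le_iff₀ hW0]
    have e' : W⁻¹ / q ^ 2 * W = 1 / q ^ 2 := by field_simp
    rw [e']
    exact hjk
  refine ⟨q, W⁻¹, k / q ^ 2, j / W, ?_, hq4.le, hWi, hΔ1.trans hq2i, hab, ?_, ?_, ?_, ?_⟩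
  · rw [Real.le_log_iff_exp_le hq0]; exact hqT.le
  · refine IsAdicSeparator.of_max hu (hΔ1.trans hq2i) ?_
    rw [← hU, ← hN]
    exact isAdicSeparator_div_pow hU2 _ _ (hN ▸ hΔ1)
  · refine IsAdicSeparator.of_max hv (hΔ1.trans hq2i) ?_
    rw [← hV, hW]
    exact isAdicSeparator_div_pow hV2 _ _ le_rfl
  · have h1 : (q ^ 2)⁻¹ ≤ k / q ^ 2 := by
      rw [inv_eq_one_div]; gcongr
    have h2 : W⁻¹ / q < W⁻¹ := div_lt_self hWi (by linarith)
    linarith [le_max_left ((k : ℝ) / q ^ 2) (j / W)]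
  · have h1 : (k : ℝ) / q ^ 2 ≤ 1 - (q ^ 2)⁻¹ := by
      rw [div_le_iff₀ (by positivity)]
      field_simp
      linarith
    have h2 : W⁻¹ / q ≤ W⁻¹ / 4 := by gcongr
    have h3 : W⁻¹ / q ^ 2 ≤ W⁻¹ / 16 := by gcongr
    have h4 : max ((k : ℝ) / q ^ 2) (j / W) ≤ k / q ^ 2 + W⁻¹ / q ^ 2 :=
      max_le (by linarith [abs_nonneg ((k : ℝ) / q ^ 2 - j / W)]) (by linarith [(abs_le.1 hab).1])
    linarith

/-! ### A single bump -/

/-- Lebesgue measure weighted by a logarithmic tent on the left of `x`. -/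
noncomputable def bumpMeasure (δ Δ x : ℝ) : Measure ℝ :=
  volume.withDensity fun y => ENNReal.ofReal (logTent δ Δ (x - y))

theorem bumpMeasure_Ico {δ α β : ℝ} (Δ x : ℝ) (hδ : 0 < δ) (h : α ≤ β) :
    bumpMeasure δ Δ x (Set.Ico α β) =
      ENNReal.ofReal (∫ y in α..β, logTent δ Δ (x - y)) := by
  have hc : Continuous fun y => logTent δ Δ (x - y) :=
    (continuous_logTent hδ Δ).comp (by fun_prop)
  rw [bumpMeasure, withDensity_apply _ measurableSet_Ico, intervalIntegral.integral_of_le h,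
    setLIntegral_congr (Ico_ae_eq_Ioc (μ := volume)), ofReal_integral_eq_lintegral_ofReal]
  · exact (hc.integrableOn_Icc).mono_set Set.Ioc_subset_Icc_self
  · exact Filter.Eventually.of_forall fun y => logTent_nonneg _ _ _

theorem bumpMeasure_univ_le {δ Δ : ℝ} (x : ℝ) (hδ : 0 < δ) (hδΔ : δ ≤ Δ) :
    bumpMeasure δ Δ x Set.univ ≤ ENNReal.ofReal Δ := by
  obtain ⟨hi, hle⟩ := integral_logTent_le_width hδ hδΔ
  rw [bumpMeasure, withDensity_apply _ MeasurableSet.univ, setLIntegral_univ,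
    ← ofReal_integral_eq_lintegral_ofReal (hi.comp_sub_left x)
      (Filter.Eventually.of_forall fun y => logTent_nonneg _ _ _), integral_sub_left_eq_self]
  exact ENNReal.ofReal_le_ofReal hle

theorem bumpMeasure_le {δ Δ : ℝ} (x : ℝ) (hδ : 0 < δ) (hδΔ : δ ≤ Δ) (S : Set ℝ) :
    bumpMeasure δ Δ x S ≤ ENNReal.ofReal (Real.log Δ - Real.log δ) * volume S := by
  refine (withDensity_mono (Filter.Eventually.of_forall fun y =>
    ENNReal.ofReal_le_ofReal (logTent_le hδ hδΔ (x - y))) S).trans ?_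
  rw [withDensity_const, Measure.smul_apply, smul_eq_mul]

theorem adicChild_subset {n : ℕ} {m k : ℤ} {j : ℕ} (hn : 0 < n) (hj : j ∈ Finset.Icc 1 n) :
    ((k : ℝ) - 1) / (n : ℝ) ^ m ≤ ((k : ℝ) - 1) / (n : ℝ) ^ m + ((j : ℝ) - 1) / (n : ℝ) ^ (m + 1) ∧
      ((k : ℝ) - 1) / (n : ℝ) ^ m + (j : ℝ) / (n : ℝ) ^ (m + 1) ≤ (k : ℝ) / (n : ℝ) ^ m := by
  obtain ⟨h1, h2⟩ := Finset.mem_Icc.1 hj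
  have h1' : (1 : ℝ) ≤ j := by exact_mod_cast h1
  have h2' : (j : ℝ) ≤ n := by exact_mod_cast h2
  have hn0 : (0 : ℝ) < n := by exact_mod_cast hn
  have hp : (0 : ℝ) < (n : ℝ) ^ m := by positivity
  rw [zpow_add_one₀ hn0.ne']
  refine ⟨le_add_of_nonneg_right (div_nonneg (by linarith) (by positivity)), ?_⟩
  have : (j : ℝ) / ((n : ℝ) ^ m * n) ≤ 1 / (n : ℝ) ^ m := by
    rw [div_le_div_iff₀ (by positivity) hp]
    nlinarith
  calc _ ≤ ((k : ℝ) - 1) / (n : ℝ) ^ m + 1 / (n : ℝ) ^ m := by gcongr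
    _ = _ := by ring

theorem volume_adicChild (n : ℕ) (m k : ℤ) (j : ℕ) :
    volume (adicChild n m k j) = ENNReal.ofReal (((n : ℝ) ^ (m + 1))⁻¹) := by
  rw [adicChild, Real.volume_Ico]
  congr 1
  ring

theorem bumpMeasure_le_of_isAdicSibling {n : ℕ} {δ Δ a x : ℝ} (hn : 0 < n) (hδ : 0 < δ)
    (hδΔ : δ ≤ Δ) (ha : IsAdicSeparator n Δ a) (hax : a ≤ x) (hxa : x - δ ≤ a)
    {J₁ J₂ : Set ℝ} (h : IsAdicSibling n J₁ J₂) :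
    bumpMeasure δ Δ x J₁ ≤ ((2 * n + 1) * n : ℕ) * (bumpMeasure δ Δ x J₂ + volume J₂) := by
  obtain ⟨m, k, i, hi, j, hj, rfl, rfl⟩ := h
  have hn0 : (0 : ℝ) < n := by exact_mod_cast hn
  have hn1 : (1 : ℝ) ≤ n := by exact_mod_cast hn
  have hp : (0 : ℝ) < (n : ℝ) ^ m := by positivity
  obtain ⟨hi1, hi2⟩ := adicChild_subset (m := m) (k := k) hn hi
  obtain ⟨hj1, hj2⟩ := adicChild_subset (m := m) (k := k) hn hj
  have hlen : ((k : ℝ) - 1) / (n : ℝ) ^ m + (j : ℝ) / (n : ℝ) ^ (m + 1) -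
      (((k : ℝ) - 1) / (n : ℝ) ^ m + ((j : ℝ) - 1) / (n : ℝ) ^ (m + 1)) =
      ((n : ℝ) ^ (m + 1))⁻¹ := by ring
  have hlen' : (k : ℝ) / (n : ℝ) ^ m - ((k : ℝ) - 1) / (n : ℝ) ^ m = ((n : ℝ) ^ m)⁻¹ := by ring
  have hpos : 0 < ((n : ℝ) ^ (m + 1))⁻¹ := by positivity
  have hmul : ((n : ℝ) ^ m)⁻¹ = n * ((n : ℝ) ^ (m + 1))⁻¹ := by
    rw [zpow_add_one₀ hn0.ne']; field_simp
  rw [volume_adicChild]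
  unfold adicChild
  refine (measure_mono (Set.Ico_subset_Ico hi1 hi2)).trans ?_
  rw [bumpMeasure_Ico _ _ hδ (by gcongr; linarith), bumpMeasure_Ico _ _ hδ (by linarith)]
  have key := integral_logTent_sub_le_of_subinterval (x := x) (n := n) hδ hδΔ hj1
    (by linarith) hj2 (by rw [hlen, hlen', hmul]) (by
      rw [hlen']
      rcases lt_or_ge ((n : ℝ) ^ m)⁻¹ Δ with h | h
      · rcases ha m k h with h' | h'
        · exact Or.inr (Or.inr (hxa.trans h'))
        · exact Or.inr (Or.inl (h'.trans hax))
      · exact Or.inl h)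
  rw [hlen] at key
  have hB : 0 ≤ ∫ y in ((k : ℝ) - 1) / (n : ℝ) ^ m + ((j : ℝ) - 1) / (n : ℝ) ^ (m + 1)..
      ((k : ℝ) - 1) / (n : ℝ) ^ m + (j : ℝ) / (n : ℝ) ^ (m + 1), logTent δ Δ (x - y) :=
    intervalIntegral.integral_nonneg (by linarith) fun t _ => logTent_nonneg _ _ _
  rw [← ENNReal.ofReal_add hB hpos.le, ← ENNReal.ofReal_natCast,
    ← ENNReal.ofReal_mul (Nat.cast_nonneg _)]
  refine ENNReal.ofReal_le_ofReal (key.trans ?_)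
  push_cast
  have : (2 * n : ℝ) ≤ (2 * n + 1) * n := by nlinarith
  nlinarith [mul_le_mul_of_nonneg_right this hB]

theorem exists_bumpMeasure {u v : ℕ} (hu : 0 < u) (hv : 0 < v) (T : ℝ) :
    ∃ (ν : Measure ℝ) (c r : ℝ), ν Set.univ ≤ 1 ∧ ν (Set.Ico 1 2) = 0 ∧
      (∃ M : ℝ≥0, ∀ S, ν S ≤ M * volume S) ∧
      (∀ n ∈ ({u, v} : Set ℕ), ∀ J₁ J₂, IsAdicSibling n J₁ J₂ →
        ν J₁ ≤ ((2 * n + 1) * n : ℕ) * (ν J₂ + volume J₂)) ∧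
      0 < r ∧ Set.Ico (c - 2 * r) (c + 2 * r) ⊆ Set.Ioo 0 1 ∧ ν (Set.Ico (c - r) (c + r)) = 0 ∧
      ENNReal.ofReal (T * r) ≤ ν (Set.Ico (c - 2 * r) (c + 2 * r)) := by
  -- On `[x - ρ, x - ρ / 2]` the tent is at least `log q - log 2`; this choice makes that at least
  -- `2T`, giving mass `Tρ` on length `ρ / 2`.
  obtain ⟨q, Δ, a, b, hqT, hq4, hΔ, hΔ1, hab, ha, hb, hx0, hx1⟩ :=
    exists_isAdicSeparator_near hu hv (2 * |T| + Real.log 2)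
  set x := max a b with hx
  have hq0 : 0 < q := by linarith
  obtain ⟨δ, hδ⟩ : ∃ δ, δ = Δ / q ^ 2 := ⟨_, rfl⟩
  obtain ⟨ρ, hρ⟩ : ∃ ρ, ρ = Δ / q := ⟨_, rfl⟩
  rw [← hδ] at hab
  rw [← hρ] at hx0 hx1
  have hδ0 : 0 < δ := by rw [hδ]; positivity
  have hρ0 : 0 < ρ := by rw [hρ]; positivity
  have hρδ : ρ = δ * q := by rw [hρ, hδ]; field_simp
  have hΔρ : Δ = ρ * q := by rw [hρ]; field_simp
  have hδρ : 4 * δ ≤ ρ := by rw [hρδ]; nlinarith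
  have hρΔ : 4 * ρ ≤ Δ := by rw [hΔρ]; nlinarith
  have hδΔ : δ ≤ Δ := by linarith
  have hxa : x - δ ≤ a := by
    have := abs_le.1 hab
    rcases max_choice a b with h | h <;> rw [hx, h] <;> linarith
  have hxb : x - δ ≤ b := by
    have := abs_le.1 hab
    rcases max_choice a b with h | h <;> rw [hx, h] <;> linarith
  have hright : ∀ α β, x ≤ α → α ≤ β → bumpMeasure δ Δ x (Set.Ico α β) = 0 := by
    intro α β h1 h2
    rw [bumpMeasure_Ico _ _ hδ0 h2, intervalIntegral.integral_congr (g := fun _ => 0)]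
    · simp
    · intro y hy
      rw [Set.uIcc_of_le h2] at hy
      exact logTent_eq_zero_of_le _ (by linarith [hy.1])
  refine ⟨bumpMeasure δ Δ x, x + ρ, ρ, ?_, hright _ _ (by linarith) (by norm_num),
    ⟨_, bumpMeasure_le x hδ0 hδΔ⟩, ?_, hρ0, ?_, hright _ _ (by linarith) (by linarith), ?_⟩
  · exact (bumpMeasure_univ_le x hδ0 hδΔ).trans (ENNReal.ofReal_le_one.2 hΔ1)
  · rintro n (rfl | rfl) J₁ J₂ h
    · exact bumpMeasure_le_of_isAdicSibling hu hδ0 hδΔ ha (le_max_left _ _) hxa h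
    · exact bumpMeasure_le_of_isAdicSibling hv hδ0 hδΔ hb (le_max_right _ _) hxb h
  · intro y hy
    exact ⟨by linarith [hy.1], by linarith [hy.2]⟩
  · refine le_trans ?_ (measure_mono (Set.Ico_subset_Ico
      (show x + ρ - 2 * ρ ≤ x - ρ by linarith) (show x - ρ / 2 ≤ x + ρ + 2 * ρ by linarith)))
    rw [bumpMeasure_Ico _ _ hδ0 (by linarith)]
    refine ENNReal.ofReal_le_ofReal ?_
    have hlow : ∀ y ∈ Set.Icc (x - ρ) (x - ρ / 2), 2 * T ≤ logTent δ Δ (x - y) := by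
      rintro y ⟨hy1, hy2⟩
      have hT := le_abs_self T
      have hlog2 : 0 < Real.log 2 := Real.log_pos (by norm_num)
      have e1 : Real.log ρ = Real.log δ + Real.log q := by
        rw [hρδ, Real.log_mul hδ0.ne' hq0.ne']
      have e2 : Real.log Δ = Real.log ρ + Real.log q := by
        rw [hΔρ, Real.log_mul hρ0.ne' hq0.ne']
      have e3 : Real.log (ρ / 2) = Real.log ρ - Real.log 2 :=
        Real.log_div hρ0.ne' (by norm_num)
      have e4 := Real.log_le_log (by linarith) (show ρ / 2 ≤ x - y by linarith)
      have e5 := Real.log_le_log (by linarith) (show x - y ≤ ρ by linarith)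
      unfold logTent
      rw [max_eq_left (show δ ≤ x - y by linarith)]
      refine le_max_of_le_right (le_min ?_ ?_) <;> linarith
    have := intervalIntegral.integral_mono_on (μ := volume) (by linarith) (by simp)
      (((continuous_logTent hδ0 Δ).comp (continuous_const.sub continuous_id)).intervalIntegrable
        (x - ρ) (x - ρ / 2)) hlow
    simp only [intervalIntegral.integral_const, smul_eq_mul] at this
    refine le_trans (le_of_eq ?_) this
    ring

/-! ### Selecting bumps by Baire category -/

/-- The sum of the measures `2⁻ⁱ • ν i` over the indices `i` selected by `A`. -/
noncomputable def selectedSum (ν : ℕ → Measure ℝ) (A : ℕ → Bool) : Measure ℝ :=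
  Measure.sum fun i => (if A i then (2⁻¹ : ℝ≥0∞) ^ i else 0) • ν i

theorem selectedSum_apply (ν : ℕ → Measure ℝ) (A : ℕ → Bool) {S : Set ℝ} (hS : MeasurableSet S) :
    selectedSum ν A S = ∑' i, (if A i then (2⁻¹ : ℝ≥0∞) ^ i else 0) * ν i S := by
  simp only [selectedSum, Measure.sum_apply _ hS, Measure.smul_apply, smul_eq_mul]

theorem tsum_weight_le (A : ℕ → Bool) : ∑' i, (if A i then (2⁻¹ : ℝ≥0∞) ^ i else 0) ≤ 2 := by
  refine (ENNReal.tsum_le_tsum (g := fun i => (2⁻¹ : ℝ≥0∞) ^ i) fun i => ?_).trans ?_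
  · split_ifs <;> simp
  · rw [ENNReal.tsum_geometric, ENNReal.one_sub_inv_two, inv_inv]

theorem selectedSum_univ_le {ν : ℕ → Measure ℝ} (hν : ∀ i, ν i Set.univ ≤ 1) (A : ℕ → Bool) :
    selectedSum ν A Set.univ ≤ 2 := by
  rw [selectedSum_apply _ _ MeasurableSet.univ]
  refine (ENNReal.tsum_le_tsum fun i => ?_).trans (tsum_weight_le A)
  exact mul_le_of_le_one_right' (hν i)

/-- The series converges uniformly in `A`, being dominated by `∑ 2⁻ⁱ`. -/
theorem continuous_selectedSum_apply {ν : ℕ → Measure ℝ} (hν : ∀ i, ν i Set.univ ≤ 1)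
    {S : Set ℝ} (hS : MeasurableSet S) : Continuous fun A => selectedSum ν A S := by
  have hS1 : ∀ i, ν i S ≤ 1 := fun i => (measure_mono (Set.subset_univ _)).trans (hν i)
  have hfin : ∀ (A : ℕ → Bool) i, (if A i then (2⁻¹ : ℝ≥0∞) ^ i else 0) * ν i S ≠ ∞ := by
    intro A i
    refine ENNReal.mul_ne_top ?_ ((hS1 i).trans_lt ENNReal.one_lt_top).ne
    split_ifs <;> simp
  have hle : ∀ (A : ℕ → Bool) i,
      (if A i then (2⁻¹ : ℝ≥0∞) ^ i else 0) * ν i S ≤ (2⁻¹ : ℝ≥0∞) ^ i := by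
    intro A i
    refine (mul_le_of_le_one_right' (hS1 i)).trans ?_
    split_ifs <;> simp
  have hc : Continuous fun A : ℕ → Bool =>
      ∑' i, ((if A i then (2⁻¹ : ℝ≥0∞) ^ i else 0) * ν i S).toReal := by
    refine continuous_tsum (u := fun i => (2⁻¹ : ℝ) ^ i) (fun i => ?_)
      (summable_geometric_of_lt_one (by norm_num) (by norm_num)) fun i A => ?_
    · exact (continuous_of_discreteTopology (f := fun b : Bool =>
        ((if b then (2⁻¹ : ℝ≥0∞) ^ i else 0) * ν i S).toReal)).comp (continuous_apply i)
    · rw [Real.norm_of_nonneg ENNReal.toReal_nonneg]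
      refine (ENNReal.toReal_mono (by simp) (hle A i)).trans (by simp)
  have he : (fun A => selectedSum ν A S) = fun A : ℕ → Bool => ENNReal.ofReal
      (∑' i, ((if A i then (2⁻¹ : ℝ≥0∞) ^ i else 0) * ν i S).toReal) := by
    funext A
    have hne : ∑' i, (if A i then (2⁻¹ : ℝ≥0∞) ^ i else 0) * ν i S ≠ ∞ := by
      rw [← selectedSum_apply _ _ hS]
      exact ((measure_mono (Set.subset_univ _)).trans_lt
        ((selectedSum_univ_le hν A).trans_lt (by simp))).ne
    rw [selectedSum_apply _ _ hS, ← ENNReal.tsum_toReal_eq (hfin A), ENNReal.ofReal_toReal hne]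
  rw [he]
  exact ENNReal.continuous_ofReal.comp hc

theorem selectedSum_update_le (ν : ℕ → Measure ℝ) (B : ℕ → Bool) (i : ℕ) {S : Set ℝ}
    (hS : MeasurableSet S) :
    selectedSum ν (Function.update B i true) S ≤ selectedSum ν B S + ν i S := by
  rw [selectedSum_apply _ _ hS, selectedSum_apply _ _ hS]
  have : ν i S = ∑' j, if j = i then ν i S else 0 := (tsum_ite_eq i fun _ => ν i S).symm
  rw [this, ← ENNReal.tsum_add]
  refine ENNReal.tsum_le_tsum fun j => ?_
  by_cases h : j = i
  · subst h
    simp only [Function.update_self, if_true]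
    refine le_add_left (mul_le_of_le_one_left' ?_)
    exact pow_le_one₀ zero_le (by simp)
  · simp [h]

theorem selectedSum_le_of_forall_eq_false {ν : ℕ → Measure ℝ} {M : ℕ → ℝ≥0}
    (hM : ∀ i S, ν i S ≤ M i * volume S) {B : ℕ → Bool} {N : ℕ} (hB : ∀ j, N ≤ j → B j = false)
    {S : Set ℝ} (hS : MeasurableSet S) :
    selectedSum ν B S ≤ (∑ j ∈ Finset.range N, M j : ℝ≥0) * volume S := by
  rw [selectedSum_apply _ _ hS, tsum_eq_sum (s := Finset.range N)]
  · rw [ENNReal.ofNNReal_finsetSum, Finset.sum_mul]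
    refine Finset.sum_le_sum fun j _ => (mul_le_of_le_one_left' ?_).trans (hM j S)
    split_ifs
    · exact pow_le_one₀ zero_le (by simp)
    · exact zero_le
  · intro j hj
    simp [hB j (by simpa using hj)]

/-- Otherwise the closed sets of selections with constant `C` cover Cantor space, and one has
interior. It contains a finite selection `B`, of bounded density, and `B` with any sufficiently late
bump added; that bump contradicts the constant. -/
theorem exists_selectedSum_not_doubling {ν : ℕ → Measure ℝ} {c r : ℕ → ℝ} {M : ℕ → ℝ≥0}
    (hν : ∀ i, ν i Set.univ ≤ 1) (hM : ∀ i S, ν i S ≤ M i * volume S) (hr : ∀ i, 0 < r i)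
    (h0 : ∀ i, ν i (Set.Ico (c i - r i) (c i + r i)) = 0)
    (hbig : ∀ i, ENNReal.ofReal (4 ^ i * r i) ≤ ν i (Set.Ico (c i - 2 * r i) (c i + 2 * r i))) :
    ∃ A, ¬ ∃ C : ℝ≥0, ∀ i,
      ((volume : Measure ℝ) + selectedSum ν A) (Set.Ico (c i - 2 * r i) (c i + 2 * r i)) ≤
        C * ((volume : Measure ℝ) + selectedSum ν A) (Set.Ico (c i - r i) (c i + r i)) := by
  by_contra! hcon
  let E : ℕ → Set (ℕ → Bool) := fun C => {A | ∀ i,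
      ((volume : Measure ℝ) + selectedSum ν A) (Set.Ico (c i - 2 * r i) (c i + 2 * r i)) ≤
        (C : ℝ≥0∞) * ((volume : Measure ℝ) + selectedSum ν A) (Set.Ico (c i - r i) (c i + r i))}
  have hclosed : ∀ C, IsClosed (E C) := by
    intro C
    simp only [E, Set.ofPred_forall, Measure.add_apply]
    refine isClosed_iInter fun i => isClosed_le ?_ ?_
    · exact continuous_const.add (continuous_selectedSum_apply hν measurableSet_Ico)
    · exact (ENNReal.continuous_const_mul (ENNReal.natCast_ne_top C)).comp
        (continuous_const.add (continuous_selectedSum_apply hν measurableSet_Ico))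
  have hcover : ⋃ C, E C = Set.univ := by
    refine Set.eq_univ_of_forall fun A => ?_
    obtain ⟨C, hC⟩ := hcon A
    obtain ⟨K, hK⟩ := exists_nat_ge C
    refine Set.mem_iUnion.2 ⟨K, fun i => (hC i).trans ?_⟩
    gcongr
    exact_mod_cast hK
  obtain ⟨C, A₀, hA₀⟩ := nonempty_interior_of_iUnion_of_closed hclosed hcover
  have ht1 : Filter.Tendsto (fun N j => if j < N then A₀ j else false) Filter.atTop
      (nhds A₀) := by
    refine tendsto_pi_nhds.2 fun j => tendsto_const_nhds.congr' ?_
    filter_upwards [Filter.eventually_gt_atTop j] with N hN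
    simp [hN]
  obtain ⟨N, hN⟩ := (ht1.eventually (isOpen_interior.mem_nhds hA₀)).exists
  obtain ⟨B, hBdef⟩ : ∃ B : ℕ → Bool, B = fun j => if j < N then A₀ j else false := ⟨_, rfl⟩
  rw [← hBdef] at hN
  have hB : ∀ j, N ≤ j → B j = false := fun j hj => by simp [hBdef, hj]
  have ht2 : Filter.Tendsto (fun i => Function.update B i true) Filter.atTop (nhds B) := by
    refine tendsto_pi_nhds.2 fun j => tendsto_const_nhds.congr' ?_
    filter_upwards [Filter.eventually_gt_atTop j] with i hi
    rw [Function.update_of_ne hi.ne]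
  have hev := ht2.eventually (isOpen_interior.mem_nhds hN)
  obtain ⟨D, hD⟩ : ∃ D : ℝ≥0, D = ∑ j ∈ Finset.range N, M j := ⟨_, rfl⟩
  have hgrow := tendsto_pow_atTop_atTop_of_one_lt (show (1 : ℝ) < 2 by norm_num)
  -- The weighted bump gives the double mass at least `2⁻ⁱ 4ⁱ r = 2ⁱ r`, against at most `2 (1 + D)
  -- r` on the interval itself.
  obtain ⟨i, hi, hi2⟩ := (hev.and (hgrow.eventually_gt_atTop (C * (2 * (1 + D))))).exists
  have hmain := interior_subset hi i
  have hri := hr i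
  have hup : ((volume : Measure ℝ) + selectedSum ν (Function.update B i true))
      (Set.Ico (c i - r i) (c i + r i)) ≤ ENNReal.ofReal ((1 + D) * (2 * r i)) := by
    have h1 := selectedSum_update_le ν B i (measurableSet_Ico (a := c i - r i) (b := c i + r i))
    have h2 := selectedSum_le_of_forall_eq_false hM hB
      (measurableSet_Ico (a := c i - r i) (b := c i + r i))
    rw [h0, add_zero] at h1
    have h3 : volume (Set.Ico (c i - r i) (c i + r i)) = ENNReal.ofReal (2 * r i) := by
      rw [Real.volume_Ico]; congr 1; ring
    rw [Measure.add_apply, add_mul, one_mul, ENNReal.ofReal_add (by positivity) (by positivity),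
      ENNReal.ofReal_mul D.coe_nonneg, ENNReal.ofReal_coe_nnreal, hD, ← h3]
    gcongr
    exact h1.trans h2
  have hlow : ENNReal.ofReal (2 ^ i * r i) ≤
      ((volume : Measure ℝ) + selectedSum ν (Function.update B i true))
      (Set.Ico (c i - 2 * r i) (c i + 2 * r i)) := by
    rw [Measure.add_apply, selectedSum_apply _ _ measurableSet_Ico]
    refine le_add_left (le_trans ?_ (ENNReal.le_tsum i))
    rw [Function.update_self, if_pos rfl]
    refine le_trans (le_of_eq ?_) (mul_le_mul_right (hbig i) _)
    have : (2⁻¹ : ℝ≥0∞) ^ i = ENNReal.ofReal ((2⁻¹ : ℝ) ^ i) := by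
      rw [ENNReal.ofReal_pow (by norm_num), ENNReal.ofReal_inv_of_pos (by norm_num)]
      simp
    rw [this, ← ENNReal.ofReal_mul (by positivity), ← mul_assoc, ← mul_pow]
    norm_num
  have hfinal := hlow.trans (hmain.trans (mul_le_mul_right hup _))
  rw [← ENNReal.ofReal_natCast, ← ENNReal.ofReal_mul (Nat.cast_nonneg _),
    ENNReal.ofReal_le_ofReal_iff (by positivity)] at hfinal
  nlinarith

/-! ### Adic doubling of the sum and the infinite family -/

theorem isAdicDoubling_of_le {n : ℕ} {μ : Measure ℝ} {D : ℝ≥0} (hD : 0 < D)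
    (hpos : ∀ m k j, μ (adicChild n m k j) ≠ 0) (hfin : ∀ m k j, μ (adicChild n m k j) ≠ ∞)
    (h : ∀ J₁ J₂, IsAdicSibling n J₁ J₂ → μ J₁ ≤ D * μ J₂) : IsAdicDoubling n μ := by
  refine ⟨D, hD, fun J₁ J₂ hJ => ?_⟩
  have h1 := h J₁ J₂ hJ
  obtain ⟨m, k, i, hi, j, hj, rfl, rfl⟩ := hJ
  have h2 := h _ _ ⟨m, k, j, hj, i, hi, rfl, rfl⟩
  refine ⟨?_, ENNReal.div_le_of_le_mul h1⟩
  rw [ENNReal.le_div_iff_mul_le (Or.inl (hpos _ _ _)) (Or.inl (hfin _ _ _)), mul_comm,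
    ← div_eq_mul_inv]
  exact ENNReal.div_le_of_le_mul' h2

/-- The additive volume errors sum because the weights total at most 2; the Lebesgue summand later
absorbs them. -/
theorem selectedSum_le_of_isAdicSibling {n : ℕ} {ν : ℕ → Measure ℝ} {D : ℝ≥0∞}
    (h : ∀ i J₁ J₂, IsAdicSibling n J₁ J₂ → ν i J₁ ≤ D * (ν i J₂ + volume J₂))
    (A : ℕ → Bool) {J₁ J₂ : Set ℝ} (hJ : IsAdicSibling n J₁ J₂) :
    selectedSum ν A J₁ ≤ D * (selectedSum ν A J₂ + 2 * volume J₂) := by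
  have hm : MeasurableSet J₁ ∧ MeasurableSet J₂ := by
    obtain ⟨m, k, i, -, j, -, rfl, rfl⟩ := hJ
    exact ⟨measurableSet_Ico, measurableSet_Ico⟩
  rw [selectedSum_apply _ _ hm.1, selectedSum_apply _ _ hm.2]
  calc _ ≤ ∑' i, (D * ((if A i then (2⁻¹ : ℝ≥0∞) ^ i else 0) * ν i J₂) +
        D * ((if A i then (2⁻¹ : ℝ≥0∞) ^ i else 0) * volume J₂)) := by
        refine ENNReal.tsum_le_tsum fun i => (mul_le_mul_right (h i J₁ J₂ hJ) _).trans ?_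
        rw [← mul_add, ← mul_add, mul_left_comm]
    _ ≤ _ := by
        rw [ENNReal.tsum_add, ENNReal.tsum_mul_left, ENNReal.tsum_mul_left, ENNReal.tsum_mul_right,
          mul_add]
        gcongr
        exact tsum_weight_le A

theorem isAdicDoubling_add_selectedSum {n : ℕ} (hn : 0 < n) {ν : ℕ → Measure ℝ} {D : ℕ}
    (hν : ∀ i, ν i Set.univ ≤ 1)
    (h : ∀ i J₁ J₂, IsAdicSibling n J₁ J₂ → ν i J₁ ≤ D * (ν i J₂ + volume J₂))
    (A : ℕ → Bool) (t : ℕ) :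
    IsAdicDoubling n (((t + 1 : ℕ) : ℝ≥0∞) • (volume : Measure ℝ) + selectedSum ν A) := by
  have hn0 : (0 : ℝ) < n := by exact_mod_cast hn
  have hadd : ∀ S, (((t + 1 : ℕ) : ℝ≥0∞) • (volume : Measure ℝ) + selectedSum ν A) S =
      ((t + 1 : ℕ) : ℝ≥0∞) * volume S + selectedSum ν A S := fun S => by simp
  have hvpos : ∀ m k j, volume (adicChild n m k j) ≠ 0 := fun m k j => by
    rw [volume_adicChild]
    exact (ENNReal.ofReal_pos.2 (by positivity)).ne'
  refine isAdicDoubling_of_le (D := ((1 + 2 * D : ℕ) : ℝ≥0)) (by positivity) ?_ ?_ ?_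
  · intro m k j
    rw [hadd]
    simp [hvpos m k j]
  · intro m k j
    rw [hadd, volume_adicChild]
    refine ENNReal.add_ne_top.2 ⟨ENNReal.mul_ne_top (ENNReal.natCast_ne_top _)
      ENNReal.ofReal_ne_top, ?_⟩
    exact ((measure_mono (Set.subset_univ _)).trans_lt
      ((selectedSum_univ_le hν A).trans_lt (by simp))).ne
  · intro J₁ J₂ hJ
    have h1 := selectedSum_le_of_isAdicSibling h A hJ
    have h2 : volume J₁ = volume J₂ := by
      obtain ⟨m, k, i, -, j, -, rfl, rfl⟩ := hJ
      rw [volume_adicChild, volume_adicChild]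
    rw [hadd, hadd, h2]
    have ht : volume J₂ ≤ ((t + 1 : ℕ) : ℝ≥0∞) * volume J₂ :=
      le_mul_of_one_le_left' (by exact_mod_cast Nat.le_add_left 1 t)
    calc _ ≤ ((t + 1 : ℕ) : ℝ≥0∞) * volume J₂ + D * (selectedSum ν A J₂ +
          2 * (((t + 1 : ℕ) : ℝ≥0∞) * volume J₂)) := by
          refine add_le_add le_rfl (h1.trans ?_)
          gcongr
      _ ≤ ((t + 1 : ℕ) : ℝ≥0∞) * volume J₂ + D * (selectedSum ν A J₂ +
          2 * (((t + 1 : ℕ) : ℝ≥0∞) * volume J₂)) + (1 + D) * selectedSum ν A J₂ := le_self_add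
      _ = _ := by push_cast; ring

theorem IsDoublingOn.mono {S T : Set ℝ} {μ : Measure ℝ} (h : IsDoublingOn T μ) (hST : S ⊆ T) :
    IsDoublingOn S μ := by
  obtain ⟨C, hC, h⟩ := h
  exact ⟨C, hC, fun c r hr hI => h c r hr (hI.trans hST)⟩

theorem theorem2p1 (u v : ℕ) (hu : 0 < u) (hv : 0 < v) :
    ∃ F : Set (Measure ℝ), F.Infinite ∧
      (F.Pairwise fun μ ν => ∀ c : ℝ≥0, μ ≠ c • ν) ∧
      ∀ μ ∈ F, IsAdicDoubling u μ ∧ IsAdicDoubling v μ ∧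
        ¬ IsDoubling μ ∧ ¬ IsDoublingOn (Set.Ioo 0 1) μ := by
  choose ν c r hν h12 hM hsib hr hsub h0 hbig using
    fun i : ℕ => exists_bumpMeasure hu hv ((4 : ℝ) ^ i)
  choose M hM using hM
  obtain ⟨A, hA⟩ := exists_selectedSum_not_doubling hν hM hr h0 hbig
  obtain ⟨σ, hσ⟩ : ∃ σ, σ = selectedSum ν A := ⟨_, rfl⟩
  obtain ⟨μ, hμ⟩ : ∃ μ : ℕ → Measure ℝ,
    μ = fun t => ((t + 1 : ℕ) : ℝ≥0∞) • (volume : Measure ℝ) + selectedSum ν A := ⟨_, rfl⟩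
  have hadd : ∀ t S, μ t S = ((t + 1 : ℕ) : ℝ≥0∞) * volume S + σ S := fun t S => by
    simp [hμ, hσ]
  have hnot : ∀ t, ¬ IsDoublingOn (Set.Ioo 0 1) (μ t) := by
    rintro t ⟨C, -, hC⟩
    refine hA ⟨C * (t + 1 : ℕ), fun i => ?_⟩
    have h1 : ∀ S, ((volume : Measure ℝ) + selectedSum ν A) S ≤ μ t S := fun S => by
      rw [hadd, Measure.add_apply, hσ]
      gcongr
      exact le_mul_of_one_le_left' (by exact_mod_cast Nat.le_add_left 1 t)
    have h2 : ∀ S, μ t S ≤ ((t + 1 : ℕ) : ℝ≥0∞) * ((volume : Measure ℝ) + selectedSum ν A) S := fun S => by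
      rw [hadd, Measure.add_apply, hσ, mul_add]
      gcongr
      exact le_mul_of_one_le_left' (by exact_mod_cast Nat.le_add_left 1 t)
    refine (h1 _).trans ((hC (c i) (r i) (hr i) (hsub i)).trans ?_)
    rw [ENNReal.coe_mul, mul_assoc]
    gcongr
    exact h2 _
  have hσ12 : σ (Set.Ico 1 2) = 0 := by
    rw [hσ, selectedSum_apply _ _ measurableSet_Ico]
    simp [h12]
  have hσfin : σ (Set.Ico 0 1) ≠ ∞ := by
    rw [hσ]
    exact ((measure_mono (Set.subset_univ _)).trans_lt
      ((selectedSum_univ_le hν A).trans_lt (by simp))).ne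
  have hσpos : σ (Set.Ico 0 1) ≠ 0 := by
    intro h
    -- If `σ` vanished on `[0, 1)`, the measure would be Lebesgue there, which doubles with constant
    -- 2.
    refine hnot 0 ⟨2, by norm_num, fun c r hr hI => ?_⟩
    have h3 : σ (Set.Ico (c - 2 * r) (c + 2 * r)) = 0 :=
      measure_mono_null (hI.trans Set.Ioo_subset_Ico_self) h
    rw [hadd, hadd, h3, Real.volume_Ico, Real.volume_Ico, add_zero, mul_add, mul_left_comm]
    refine le_add_right (mul_le_mul_right (le_of_eq ?_) _)
    rw [show ((2 : ℝ≥0) : ℝ≥0∞) = ENNReal.ofReal 2 by simp, ← ENNReal.ofReal_mul (by norm_num)]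
    congr 1
    ring
  have hval12 : ∀ t, μ t (Set.Ico 1 2) = ((t + 1 : ℕ) : ℝ≥0∞) := fun t => by
    rw [hadd, hσ12, Real.volume_Ico]
    norm_num
  have hval01 : ∀ t, μ t (Set.Ico 0 1) = ((t + 1 : ℕ) : ℝ≥0∞) + σ (Set.Ico 0 1) := fun t => by
    rw [hadd, Real.volume_Ico]
    norm_num
  -- On `[1, 2)` only the Lebesgue part is seen. Cancelling it on `[0, 1)` leaves `σ = a σ` with
  -- positive finite mass, forcing `a = 1`.
  have hmul : ∀ s t (a : ℝ≥0), μ s = a • μ t → s = t := by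
    intro s t a h
    have e1 := congrArg (fun m => m (Set.Ico (1 : ℝ) 2)) h
    have e2 := congrArg (fun m => m (Set.Ico (0 : ℝ) 1)) h
    simp only [Measure.smul_apply, hval12, hval01, ENNReal.smul_def, smul_eq_mul] at e1 e2
    rw [mul_add, ← e1] at e2
    have e3 := (ENNReal.add_right_inj (ENNReal.natCast_ne_top (s + 1))).1 e2
    have e4 : (a : ℝ≥0∞) = 1 := by
      have : (1 : ℝ≥0∞) * σ (Set.Ico 0 1) = a * σ (Set.Ico 0 1) := by rw [one_mul]; exact e3
      exact ((ENNReal.mul_left_inj hσpos hσfin).1 this).symm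
    rw [e4, one_mul] at e1
    have : s + 1 = t + 1 := by exact_mod_cast e1
    omega
  refine ⟨Set.range μ, ?_, ?_, ?_⟩
  · exact Set.infinite_range_of_injective fun s t h => hmul s t 1 (by rw [h, one_smul])
  · rintro _ ⟨s, rfl⟩ _ ⟨t, rfl⟩ hne a h
    exact hne (by rw [hmul s t a h])
  · rintro _ ⟨t, rfl⟩
    refine ⟨?_, ?_, fun h => hnot t (h.mono (Set.subset_univ _)), hnot t⟩
    · rw [hμ]
      exact isAdicDoubling_add_selectedSum hu hν (fun i => hsib i u (by simp)) A t
    · rw [hμ]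
      exact isAdicDoubling_add_selectedSum hv hν (fun i => hsib i v (by simp)) A t
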